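/- Let $q\ge 2$ be an integer and $\Sigma_q=\{0,1,\dots,q-1\}$. For integers $n\ge R\ge 0$, a code $\mathcal C\subseteq\Sigma_q^n$ is called an $R$-deletion-covering code if every word $y\in\Sigma_q^{n-R}$ can be obtained from some codeword $c\in\mathcal C$ by deleting exactly $R$ symbols (i.e. $y$ is a, not necessarily contiguous, subsequence of $c$). Let $K_D^q(n,R)$ be the smallest cardinality of an $R$-deletion-covering code $\mathcal C\subseteq\Sigma_q^n$, and define the optimal density and the asymptotic optimal density $$\mu_D^q(n,R)=\frac{K_D^q(n,R)\,n^R(q-1)^R}{q^n\,R!},\qquad \mu_D^{q,*}(R)=\limsup_{n\to\infty}\mu_D^q(n,R)$$ (the limsup being taken in the extended reals). Write $\mu_D^{*}(R)=\mu_D^{2,*}(R)$ in the binary case, and let $\log$ be the natural logarithm. **Theorem.** For all integers $R\ge 2$ and $q\ge 2$, $\mu_D^{q,*}(1)$ is finite and $$\mu_D^{q,*}(R)\le e\bigl(R\log R+\sqrt{2R\log R}+1\bigr)\,\mu_D^{q,*}(1).$$ In particular, in the binary case, $$\mu_D^{*}(R)\le e\bigl(R\log R+\sqrt{2R\log R}+1\bigr).$$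 -/

import Mathlib

/-- Words over the `q`-ary alphabet `Σ_q = {0, 1, …, q - 1}` are lists over `Fin q`; the words of
length `n` are those lists whose length is `n`. -/
abbrev Word (q : ℕ) : Type := List (Fin q)

/-- The radius-`t` deletion ball around `x`: the words obtained from `x` by deleting exactly `t`
symbols, i.e. the subsequences of `x` (`List.Sublist` need not be contiguous) which are shorter
than `x` by exactly `t`. -/
def deletionBall {q : ℕ} (x : Word q) (t : ℕ) : Set (Word q) :=
  {y | y.Sublist x ∧ y.length + t = x.length}

/-- `C ⊆ Σ_q^n` is an `R`-deletion-covering code of length `n`: every word of length `n - R`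
lies in the radius-`R` deletion ball of some codeword. -/
def IsDeletionCoveringCode {q : ℕ} (n R : ℕ) (C : Finset (Word q)) : Prop :=
  (∀ c ∈ C, c.length = n) ∧
    ∀ y : Word q, y.length + R = n → ∃ c ∈ C, y ∈ deletionBall c R

/-- `K_D^q(n, R)`: the smallest cardinality of an `R`-deletion-covering code of length `n`
over the `q`-ary alphabet. -/
noncomputable def minDeletionCoveringCard (q n R : ℕ) : ℕ :=
  sInf {k : ℕ | ∃ C : Finset (Word q), IsDeletionCoveringCode n R C ∧ C.card = k}

/-- The optimal density `μ_D^q(n, R) = K_D^q(n, R) n^R (q - 1)^R / (q^n R!)`. -/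
noncomputable def deletionDensity (q n R : ℕ) : ℝ :=
  ((minDeletionCoveringCard q n R : ℝ) * (n : ℝ) ^ R * ((q : ℝ) - 1) ^ R) /
    ((q : ℝ) ^ n * (R.factorial : ℝ))

/-- The asymptotic optimal density `μ_D^{q,*}(R) = limsup_{n → ∞} μ_D^q(n, R)`, taken in the
extended reals, where it always exists. -/
noncomputable def asympDeletionDensity (q R : ℕ) : EReal :=
  Filter.limsup (fun n : ℕ => (deletionDensity q n R : EReal)) Filter.atTop

/-! Write R = k + 1 and n = l + k + b, and split a word of length n - R into a prefix of length l
and a suffix of length b - 1. Greedily chosen words of length l + k cover most prefixes with k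
deletions; appending a 1-deletion code of length b handles every word with such a prefix. Each
missed prefix is copied unchanged, and an R-deletion code of length b + k absorbs all deletions in
the suffix. This is `minDeletionCoveringCard_recursion`.

A greedy step achieves at least the average coverage, so about x/p words leave at most a fraction
exp(-x) uncovered, where p is the supersequence density. With b = ⌊n/R⌋ the densities satisfy,
asymptotically, μ(n, R) ≤ e·x·μ(b, 1) + exp(-x)·R^R·μ(b + k, R), the factor e bounding (1 + 1/k)^k.
Put M = R log R, y = √(2M), x = M + y: the contraction factor is exp(-y), so the limsup is at most
e(M + y)/(1 - exp(-y)) times μ*(1). The estimate exp y ≥ 1 + y + y²/2 = 1 + y + M bounds this by e(M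
+ y + 1) times μ*(1).

Finiteness of μ*(1), and μ*(1) ≤ 1 for q = 2, come from Varshamov–Tenengolts codes. -/

/-! ### Supersequence counts and greedy partial coverings -/

/-- The finite set of words of length `n` over `Σ_q`. -/
def wordsOfLength (q n : ℕ) : Finset (Word q) :=
  Finset.univ.image (List.ofFn : (Fin n → Fin q) → Word q)

theorem mem_wordsOfLength {q n : ℕ} {x : Word q} : x ∈ wordsOfLength q n ↔ x.length = n := by
  simp only [wordsOfLength, Finset.mem_image, Finset.mem_univ, true_and]
  constructor
  · rintro ⟨f, rfl⟩
    simp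
  · rintro rfl
    exact ⟨x.get, List.ofFn_get x⟩

theorem card_wordsOfLength (q n : ℕ) : (wordsOfLength q n).card = q ^ n := by
  rw [wordsOfLength, Finset.card_image_of_injective _ List.ofFn_injective]
  simp

/-- A word of length `k` has at least `C(n, k) (q - 1)^(n - k)` supersequences of length `n`. -/
theorem choose_mul_pow_le_card_supersequences {q : ℕ} (n : ℕ) (w : Word q) :
    n.choose w.length * (q - 1) ^ (n - w.length) ≤
      ((wordsOfLength q n).filter (fun x => w.Sublist x)).card := by
  induction n generalizing w with
  | zero =>
    cases w with
    | nil =>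
      simp [card_wordsOfLength]
    | cons a w => simp
  | succ n ih =>
    cases w with
    | nil =>
      simp only [List.nil_sublist, Finset.filter_true, card_wordsOfLength, List.length_nil,
        Nat.choose_zero_right, one_mul, Nat.sub_zero]
      exact Nat.pow_le_pow_left (Nat.sub_le _ _) _
    | cons a w =>
      set S := (wordsOfLength q n).filter (fun x => w.Sublist x) with hS
      set T := (wordsOfLength q n).filter (fun x => (a :: w).Sublist x) with hT
      -- Split by first letter: after `a` only `w` remains to be embedded, after any of the q - 1
      -- other letters all of `a :: w` does. The two counts combine by Pascal's rule.
      have hsub : S.image (List.cons a) ∪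
          ((Finset.univ.erase a) ×ˢ T).image (fun p => p.1 :: p.2) ⊆
          (wordsOfLength q (n + 1)).filter (fun x => (a :: w).Sublist x) := by
        intro x hx
        simp only [Finset.mem_union, Finset.mem_image, Finset.mem_product, hS, hT,
          Finset.mem_filter, mem_wordsOfLength, Prod.exists] at hx ⊢
        rcases hx with ⟨y, ⟨hy, hwy⟩, rfl⟩ | ⟨b, y, ⟨-, hy, hwy⟩, rfl⟩
        · exact ⟨by simp [hy], hwy.cons_cons a⟩
        · exact ⟨by simp [hy], hwy.cons b⟩
      have hdisj : Disjoint (S.image (List.cons a))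
          (((Finset.univ.erase a) ×ˢ T).image (fun p => p.1 :: p.2)) := by
        rw [Finset.disjoint_left]
        intro x hx hx'
        simp only [Finset.mem_image, Finset.mem_product, Finset.mem_erase, Prod.exists] at hx hx'
        obtain ⟨y, -, rfl⟩ := hx
        obtain ⟨b, z, ⟨⟨hb, -⟩, -⟩, h⟩ := hx'
        exact hb (List.cons.inj h).1
      have hcard := Finset.card_le_card hsub
      rw [Finset.card_union_of_disjoint hdisj,
        Finset.card_image_of_injective _ (List.cons_injective),
        Finset.card_image_of_injective _ (by
          rintro ⟨b, y⟩ ⟨c, z⟩ h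
          simpa using h),
        Finset.card_product, Finset.card_erase_of_mem (Finset.mem_univ a), Finset.card_univ,
        Fintype.card_fin] at hcard
      refine le_trans ?_ hcard
      have h1 := ih w
      have h2 := Nat.mul_le_mul_left (q - 1) (ih (a :: w))
      refine le_trans ?_ (add_le_add h1 h2)
      simp only [List.length_cons]
      rw [Nat.choose_succ_succ, add_mul, Nat.add_sub_add_right]
      refine add_le_add le_rfl ?_
      rcases Nat.lt_or_ge n (w.length + 1) with h | h
      · simp [Nat.choose_eq_zero_of_lt h]
      · have : n - w.length = (n - (w.length + 1)) + 1 := by omega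
        rw [this, pow_succ]
        exact le_of_eq (by ring)

theorem choose_mul_pow_le_pow {q : ℕ} (hq : 1 ≤ q) (l k : ℕ) :
    (l + k).choose k * (q - 1) ^ k ≤ q ^ (l + k) := by
  have h := choose_mul_pow_le_card_supersequences (l + k) (List.replicate l (⟨0, hq⟩ : Fin q))
  rw [List.length_replicate, Nat.add_sub_cancel_left, Nat.choose_symm_add] at h
  exact h.trans ((Finset.card_filter_le _ _).trans (card_wordsOfLength q _).le)

/-- Some word of length `l + k` covers at least the average share of a set of words of
length `l`. -/
theorem exists_word_covering_average {q : ℕ} (hq : 1 ≤ q) (l k : ℕ) (U : Finset (Word q))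
    (hU : U ⊆ wordsOfLength q l) :
    ∃ c ∈ wordsOfLength q (l + k), U.card * ((l + k).choose k * (q - 1) ^ k) ≤
      q ^ (l + k) * (U.filter (fun y => y.Sublist c)).card := by
  by_contra! h
  have hne : (wordsOfLength q (l + k)).Nonempty := by
    rw [← Finset.card_pos, card_wordsOfLength]
    positivity
  have h1 := Finset.sum_lt_sum_of_nonempty hne h
  rw [← Finset.mul_sum, Finset.sum_const, card_wordsOfLength, smul_eq_mul] at h1
  have h2 := lt_of_mul_lt_mul_left h1 (Nat.zero_le _)
  -- Double count the pairs (y, c) with y in `U` a subsequence of c.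
  have h3 := Finset.sum_card_bipartiteAbove_eq_sum_card_bipartiteBelow
    (s := U) (t := wordsOfLength q (l + k)) (fun y c => y.Sublist c)
  simp only [Finset.bipartiteAbove, Finset.bipartiteBelow] at h3
  rw [← h3] at h2
  refine absurd h2 (not_lt.2 ?_)
  rw [← smul_eq_mul]
  refine Finset.card_nsmul_le_sum _ _ _ fun y hy => ?_
  have h4 := choose_mul_pow_le_card_supersequences (l + k) y
  rwa [mem_wordsOfLength.1 (hU hy), Nat.add_sub_cancel_left, Nat.choose_symm_add] at h4

/-- Greedy partial covering: `m` words of length `l + k` suffice to cover all but a fraction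
`(1 - p)^m` of the words of length `l`, with `p = C(l + k, k) (q - 1)^k / q^(l + k)`. -/
theorem exists_partial_covering {q : ℕ} (hq : 1 ≤ q) (l k m : ℕ) :
    ∃ A : Finset (Word q), A ⊆ wordsOfLength q (l + k) ∧ A.card ≤ m ∧
      (((wordsOfLength q l).filter (fun y => ∀ c ∈ A, ¬ y.Sublist c)).card : ℝ) ≤
        (1 - (((l + k).choose k * (q - 1) ^ k : ℕ) : ℝ) / (q : ℝ) ^ (l + k)) ^ m *
          (q : ℝ) ^ l := by
  have hq0 : (0 : ℝ) < (q : ℝ) ^ (l + k) := by positivity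
  induction m with
  | zero => exact ⟨∅, by simp, by simp, by simp [card_wordsOfLength]⟩
  | succ m ih =>
    obtain ⟨A, hA, hAm, hAU⟩ := ih
    set U := (wordsOfLength q l).filter (fun y => ∀ c ∈ A, ¬ y.Sublist c) with hU
    obtain ⟨c, hc, hcU⟩ := exists_word_covering_average hq l k U (Finset.filter_subset _ _)
    set I := (l + k).choose k * (q - 1) ^ k with hI
    refine ⟨insert c A, Finset.insert_subset hc hA,
      (Finset.card_insert_le _ _).trans (by omega), ?_⟩
    have hEq : (wordsOfLength q l).filter (fun y => ∀ d ∈ insert c A, ¬ y.Sublist d) =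
        U.filter (fun y => ¬ y.Sublist c) := by
      ext y
      simp only [hU, Finset.mem_filter, Finset.mem_insert, forall_eq_or_imp]
      tauto
    rw [hEq]
    have hsum := Finset.card_filter_add_card_filter_not (s := U) (fun y => y.Sublist c)
    have hsum' : ((U.filter (fun y => y.Sublist c)).card : ℝ) +
        ((U.filter (fun y => ¬ y.Sublist c)).card : ℝ) = U.card := by exact_mod_cast hsum
    have hcU' : (U.card : ℝ) * (I : ℝ) ≤
        (q : ℝ) ^ (l + k) * ((U.filter (fun y => y.Sublist c)).card : ℝ) := by exact_mod_cast hcU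
    have hI1 : (I : ℝ) ≤ (q : ℝ) ^ (l + k) := by exact_mod_cast choose_mul_pow_le_pow hq l k
    have hp : (0 : ℝ) ≤ 1 - (I : ℝ) / (q : ℝ) ^ (l + k) := by
      rw [sub_nonneg, div_le_one hq0]
      exact hI1
    have hcov : (U.card : ℝ) * ((I : ℝ) / (q : ℝ) ^ (l + k)) ≤
        ((U.filter (fun y => y.Sublist c)).card : ℝ) := by
      rw [← mul_div_assoc, div_le_iff₀ hq0]
      linarith
    calc ((U.filter (fun y => ¬ y.Sublist c)).card : ℝ)
        ≤ (1 - (I : ℝ) / (q : ℝ) ^ (l + k)) * U.card := by linarith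
      _ ≤ (1 - (I : ℝ) / (q : ℝ) ^ (l + k)) *
          ((1 - (I : ℝ) / (q : ℝ) ^ (l + k)) ^ m * (q : ℝ) ^ l) := by gcongr
      _ = _ := by ring

/-! ### Recursion for code sizes -/

theorem IsDeletionCoveringCode.minDeletionCoveringCard_le {q n R : ℕ} {C : Finset (Word q)}
    (hC : IsDeletionCoveringCode n R C) : minDeletionCoveringCard q n R ≤ C.card :=
  Nat.sInf_le ⟨C, hC, rfl⟩

theorem exists_isDeletionCoveringCode_card_eq {q : ℕ} (hq : 1 ≤ q) (n R : ℕ) :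
    ∃ C : Finset (Word q), IsDeletionCoveringCode n R C ∧
      C.card = minDeletionCoveringCard q n R := by
  -- Nonemptiness matters: `sInf ∅ = 0` would be a junk value. The code of all words works, by
  -- padding y with R zeros.
  refine Nat.sInf_mem (s := {k : ℕ | ∃ C : Finset (Word q), IsDeletionCoveringCode n R C ∧
    C.card = k}) ⟨_, wordsOfLength q n, ⟨fun c hc => mem_wordsOfLength.1 hc, fun y hy => ?_⟩, rfl⟩
  have hlen : (y ++ List.replicate R (⟨0, hq⟩ : Fin q)).length = n := by simp [hy]
  exact ⟨_, mem_wordsOfLength.2 hlen, List.sublist_append_left _ _, by rw [hlen, hy]⟩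

/-- A covering code for `R = k + 1` deletions in length `l + k + b`: greedy words of length `l + k`
are followed by a `1`-deletion-covering code, and the words of length `l` which they leave
uncovered are followed by an `R`-deletion-covering code. -/
theorem minDeletionCoveringCard_recursion {q : ℕ} (hq : 1 ≤ q) (l k b m : ℕ) (hb : 1 ≤ b) :
    (minDeletionCoveringCard q (l + k + b) (k + 1) : ℝ) ≤
      m * minDeletionCoveringCard q b 1 +
      (1 - (((l + k).choose k * (q - 1) ^ k : ℕ) : ℝ) / (q : ℝ) ^ (l + k)) ^ m * (q : ℝ) ^ l *
        minDeletionCoveringCard q (b + k) (k + 1) := by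
  obtain ⟨A, hA, hAm, hAU⟩ := exists_partial_covering hq l k m
  obtain ⟨C, hC, hCcard⟩ := exists_isDeletionCoveringCode_card_eq hq b 1
  obtain ⟨D, hD, hDcard⟩ := exists_isDeletionCoveringCode_card_eq hq (b + k) (k + 1)
  set U := (wordsOfLength q l).filter (fun y => ∀ c ∈ A, ¬ y.Sublist c) with hU
  let E : Finset (Word q) := (A ×ˢ C).image (fun p => p.1 ++ p.2) ∪
    (U ×ˢ D).image (fun p => p.1 ++ p.2)
  have hE : IsDeletionCoveringCode (l + k + b) (k + 1) E := by
    have hlen : ∀ c ∈ E, c.length = l + k + b := by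
      intro c hc
      simp only [E, Finset.mem_union, Finset.mem_image, Finset.mem_product, Prod.exists] at hc
      rcases hc with ⟨u, v, ⟨hu, hv⟩, rfl⟩ | ⟨u, v, ⟨hu, hv⟩, rfl⟩
      · rw [List.length_append, mem_wordsOfLength.1 (hA hu), hC.1 v hv]
      · rw [List.length_append, mem_wordsOfLength.1 (Finset.mem_filter.1 hu).1, hD.1 v hv]
        omega
    refine ⟨hlen, fun y hy => ?_⟩
    suffices h : ∃ c ∈ E, y.Sublist c by
      obtain ⟨c, hc, hyc⟩ := h
      exact ⟨c, hc, hyc, by rw [hlen c hc, hy]⟩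
    have htake : (y.take l).length = l := by rw [List.length_take]; omega
    have hdrop : (y.drop l).length + 1 = b := by rw [List.length_drop]; omega
    by_cases hyU : y.take l ∈ U
    -- The prefix is kept intact, so all k + 1 deletions fall in the suffix: (b - 1) + (k + 1) = b +
    -- k.
    · obtain ⟨d, hd, hyd, -⟩ := hD.2 (y.drop l) (by omega)
      refine ⟨y.take l ++ d, Finset.mem_union_right _ (Finset.mem_image.2
        ⟨(y.take l, d), Finset.mem_product.2 ⟨hyU, hd⟩, rfl⟩), ?_⟩
      conv_lhs => rw [← List.take_append_drop l y]
      exact (List.Sublist.refl _).append hyd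
    · obtain ⟨d, hd, hyd, -⟩ := hC.2 (y.drop l) hdrop
      simp only [hU, Finset.mem_filter, mem_wordsOfLength, htake, true_and, not_forall,
        not_not] at hyU
      obtain ⟨c, hc, hyc⟩ := hyU
      refine ⟨c ++ d, Finset.mem_union_left _ (Finset.mem_image.2
        ⟨(c, d), Finset.mem_product.2 ⟨hc, hd⟩, rfl⟩), ?_⟩
      conv_lhs => rw [← List.take_append_drop l y]
      exact hyc.append hyd
  have hcard : E.card ≤ A.card * C.card + U.card * D.card := by
    refine (Finset.card_union_le _ _).trans (add_le_add ?_ ?_) <;>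
    exact Finset.card_image_le.trans (Finset.card_product _ _).le
  have h1 : (minDeletionCoveringCard q (l + k + b) (k + 1) : ℝ) ≤
      (A.card : ℝ) * C.card + (U.card : ℝ) * D.card := by
    exact_mod_cast hE.minDeletionCoveringCard_le.trans hcard
  refine h1.trans ?_
  rw [hCcard, hDcard]
  have hAm' : (A.card : ℝ) ≤ m := by exact_mod_cast hAm
  gcongr

/-! ### Varshamov–Tenengolts codes and the case of one deletion -/

/-- The number of nonzero symbols of a word. -/
def wordWeight {q : ℕ} (hq : 2 ≤ q) : Word q → ℕ
  | [] => 0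
  | b :: x => (if b = ⟨0, by omega⟩ then 0 else 1) + wordWeight hq x

/-- The Varshamov–Tenengolts checksum, i.e. the sum of the positions of the nonzero symbols. -/
def vtSum {q : ℕ} (hq : 2 ≤ q) : Word q → ℕ
  | [] => 0
  | b :: x => vtSum hq x + wordWeight hq (b :: x)

theorem wordWeight_le_length {q : ℕ} (hq : 2 ≤ q) (y : Word q) :
    wordWeight hq y ≤ y.length := by
  induction y with
  | nil => simp [wordWeight]
  | cons b y ih =>
    simp only [wordWeight, List.length_cons]
    split_ifs <;> omega

/-- An inserted 0 raises the checksum by the number of nonzero symbols to its right, which takes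
every value from 0 to the weight. -/
theorem exists_insert_zero {q : ℕ} (hq : 2 ≤ q) (y : Word q) (d : ℕ) (hd : d ≤ wordWeight hq y) :
    ∃ x : Word q, y.Sublist x ∧ x.length = y.length + 1 ∧ wordWeight hq x = wordWeight hq y ∧
      vtSum hq x = vtSum hq y + d := by
  induction y generalizing d with
  | nil =>
    refine ⟨[⟨0, by omega⟩], by simp, by simp, by simp [wordWeight], ?_⟩
    simp only [wordWeight] at hd
    simp [vtSum, wordWeight]
    omega
  | cons b y ih =>
    by_cases h : d ≤ wordWeight hq y
    · obtain ⟨x, h1, h2, h3, h4⟩ := ih d h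
      refine ⟨b :: x, h1.cons_cons b, by simp [h2], by simp [wordWeight, h3], ?_⟩
      simp only [vtSum, wordWeight, h3, h4]
      omega
    · refine ⟨⟨0, by omega⟩ :: b :: y, List.sublist_cons_self _ _, by simp,
        by simp [wordWeight], ?_⟩
      simp only [vtSum, wordWeight, if_true] at hd ⊢
      split_ifs at hd ⊢ <;> omega

/-- An inserted 1 contributes its own position and shifts the nonzero symbols to its right; the
total increase is weight + 1 + d, where d is the number of zeros to its left. These increments begin
just above those obtained by inserting 0. -/
theorem exists_insert_one {q : ℕ} (hq : 2 ≤ q) (y : Word q) (d : ℕ)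
    (hd : d + wordWeight hq y ≤ y.length) :
    ∃ x : Word q, y.Sublist x ∧ x.length = y.length + 1 ∧
      wordWeight hq x = wordWeight hq y + 1 ∧
      vtSum hq x = vtSum hq y + wordWeight hq y + 1 + d := by
  induction y generalizing d with
  | nil =>
    refine ⟨[⟨1, by omega⟩], by simp, by simp, by simp [wordWeight], ?_⟩
    simp only [wordWeight, List.length_nil] at hd
    simp [vtSum, wordWeight]
    omega
  | cons b y ih =>
    have hfront : d = 0 → ∃ x : Word q, (b :: y).Sublist x ∧ x.length = (b :: y).length + 1 ∧
        wordWeight hq x = wordWeight hq (b :: y) + 1 ∧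
        vtSum hq x = vtSum hq (b :: y) + wordWeight hq (b :: y) + 1 + d := by
      rintro rfl
      have h10 : (⟨1, by omega⟩ : Fin q) ≠ ⟨0, by omega⟩ := by simp
      refine ⟨⟨1, by omega⟩ :: b :: y, List.sublist_cons_self _ _, by simp, ?_, ?_⟩
      · rw [wordWeight, if_neg h10, add_comm]
      · rw [vtSum, wordWeight, if_neg h10]
        omega
    have hstep : ∀ d', d' + wordWeight hq y ≤ y.length →
        d' + 1 + wordWeight hq y = d + wordWeight hq (b :: y) →
        ∃ x : Word q, (b :: y).Sublist x ∧ x.length = (b :: y).length + 1 ∧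
        wordWeight hq x = wordWeight hq (b :: y) + 1 ∧
        vtSum hq x = vtSum hq (b :: y) + wordWeight hq (b :: y) + 1 + d := by
      intro d' hd' he
      obtain ⟨x, h1, h2, h3, h4⟩ := ih d' hd'
      refine ⟨b :: x, h1.cons_cons b, by simp [h2], by simp only [wordWeight, h3]; omega, ?_⟩
      simp only [vtSum, wordWeight, h3, h4] at he ⊢
      omega
    by_cases hb : b = ⟨0, by omega⟩
    · rcases Nat.eq_zero_or_pos d with h | h
      · exact hfront h
      · simp only [wordWeight, if_pos hb, List.length_cons] at hd
        exact hstep (d - 1) (by omega) (by simp only [wordWeight, if_pos hb]; omega)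
    · simp only [wordWeight, if_neg hb, List.length_cons] at hd
      exact hstep d (by omega) (by simp only [wordWeight, if_neg hb]; omega)

theorem exists_insert_vtSum_eq {q : ℕ} (hq : 2 ≤ q) (y : Word q) (d : ℕ)
    (hd : d ≤ y.length + 1) :
    ∃ x : Word q, y.Sublist x ∧ x.length = y.length + 1 ∧ vtSum hq x = vtSum hq y + d := by
  rcases Nat.lt_or_ge (wordWeight hq y) d with h | h
  · obtain ⟨x, h1, h2, -, h4⟩ := exists_insert_one hq y (d - wordWeight hq y - 1) (by
      have := wordWeight_le_length hq y
      omega)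
    exact ⟨x, h1, h2, by omega⟩
  · obtain ⟨x, h1, h2, -, h4⟩ := exists_insert_zero hq y d h
    exact ⟨x, h1, h2, h4⟩

/-- The words of length `n` with a prescribed checksum modulo `n + 1` form a
`1`-deletion-covering code. -/
theorem isDeletionCoveringCode_vt {q : ℕ} (hq : 2 ≤ q) (n : ℕ) (r : ZMod (n + 1)) :
    IsDeletionCoveringCode n 1
      ((wordsOfLength q n).filter (fun x => (vtSum hq x : ZMod (n + 1)) = r)) := by
  refine ⟨fun c hc => mem_wordsOfLength.1 (Finset.mem_filter.1 hc).1, fun y hy => ?_⟩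
  obtain ⟨x, h1, h2, h3⟩ := exists_insert_vtSum_eq hq y (r - (vtSum hq y : ZMod (n + 1))).val
    (by
      have := ZMod.val_lt (r - (vtSum hq y : ZMod (n + 1)))
      omega)
  refine ⟨x, Finset.mem_filter.2 ⟨mem_wordsOfLength.2 (by omega), ?_⟩, h1, h2.symm⟩
  rw [h3]
  simp

/-- The n + 1 checksum classes partition all words, and each is a covering code. -/
theorem succ_mul_minDeletionCoveringCard_one_le {q : ℕ} (hq : 2 ≤ q) (n : ℕ) :
    (n + 1) * minDeletionCoveringCard q n 1 ≤ q ^ n := by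
  have h := Finset.card_eq_sum_card_fiberwise (s := wordsOfLength q n) (t := Finset.univ)
    (f := fun x => (vtSum hq x : ZMod (n + 1))) (fun _ _ => Finset.mem_coe.2 (Finset.mem_univ _))
  rw [card_wordsOfLength] at h
  rw [h]
  have := Finset.card_nsmul_le_sum (Finset.univ : Finset (ZMod (n + 1)))
    (fun r => ((wordsOfLength q n).filter (fun x => (vtSum hq x : ZMod (n + 1)) = r)).card)
    (minDeletionCoveringCard q n 1)
    (fun r _ => (isDeletionCoveringCode_vt hq n r).minDeletionCoveringCard_le)
  simpa [ZMod.card] using this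

/-! ### Recursion for densities -/

theorem deletionDensity_nonneg {q : ℕ} (hq : 1 ≤ q) (n R : ℕ) : 0 ≤ deletionDensity q n R := by
  have h : (0 : ℝ) ≤ (q : ℝ) - 1 := by
    rw [sub_nonneg]
    exact_mod_cast hq
  unfold deletionDensity
  positivity

theorem deletionDensity_one_le {q : ℕ} (hq : 2 ≤ q) (n : ℕ) :
    deletionDensity q n 1 ≤ (q : ℝ) - 1 := by
  have h : (0 : ℝ) ≤ (q : ℝ) - 1 := by
    rw [sub_nonneg]
    exact_mod_cast (by omega : 1 ≤ q)
  have hK : ((n : ℝ) + 1) * minDeletionCoveringCard q n 1 ≤ (q : ℝ) ^ n := by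
    exact_mod_cast succ_mul_minDeletionCoveringCard_one_le hq n
  have hq0 : (0 : ℝ) < (q : ℝ) ^ n := by positivity
  rw [deletionDensity, Nat.factorial_one, Nat.cast_one, mul_one, pow_one, pow_one,
    div_le_iff₀ hq0, mul_comm]
  gcongr
  have : (0 : ℝ) ≤ minDeletionCoveringCard q n 1 := Nat.cast_nonneg _
  linarith

theorem deletionDensity_recursion {q : ℕ} (hq : 2 ≤ q) (l k b : ℕ) (hb : 1 ≤ b) {x : ℝ}
    (hx : 0 ≤ x) :
    deletionDensity q (l + k + b) (k + 1) ≤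
      ((l + k + b : ℕ) : ℝ) ^ (k + 1) / ((k + 1).factorial * b * (l + k).choose k) *
          (x + (l + k).choose k * ((q : ℝ) - 1) ^ k / (q : ℝ) ^ (l + k)) *
          deletionDensity q b 1 +
        Real.exp (-x) * (((l + k + b : ℕ) : ℝ) / ((b + k : ℕ) : ℝ)) ^ (k + 1) *
          deletionDensity q (b + k) (k + 1) := by
  set I : ℝ := (l + k).choose k * ((q : ℝ) - 1) ^ k with hI
  have hQ : (0 : ℝ) < (q : ℝ) - 1 := by
    rw [sub_pos]
    exact_mod_cast (by omega : 1 < q)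
  have hch : (0 : ℝ) < (l + k).choose k := by
    exact_mod_cast Nat.choose_pos (Nat.le_add_left k l)
  have hI0 : 0 < I := by positivity
  have hq0 : (0 : ℝ) < q := by positivity
  have hIcast : (((l + k).choose k * (q - 1) ^ k : ℕ) : ℝ) = I := by
    rw [hI, Nat.cast_mul, Nat.cast_pow, Nat.cast_sub (by omega), Nat.cast_one]
  have hI1 : I ≤ (q : ℝ) ^ (l + k) := by
    rw [← hIcast]
    exact_mod_cast choose_mul_pow_le_pow (by omega) l k
  have hbR : (0 : ℝ) < b := by exact_mod_cast hb
  -- With p = I / q^(l + k), taking m ≥ x/p gives (1 - p)^m ≤ exp(-x). Rounding up costs at most one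
  -- word, the source of the vanishing summand p added to x.
  set m : ℕ := ⌈x * (q : ℝ) ^ (l + k) / I⌉₊ with hm
  have hm1 : x * (q : ℝ) ^ (l + k) / I ≤ m := Nat.le_ceil _
  have hm2 : (m : ℝ) ≤ x * (q : ℝ) ^ (l + k) / I + 1 := (Nat.ceil_lt_add_one (by positivity)).le
  have hpow : (1 - I / (q : ℝ) ^ (l + k)) ^ m ≤ Real.exp (-x) := by
    have h0 : 0 ≤ 1 - I / (q : ℝ) ^ (l + k) := by
      rw [sub_nonneg, div_le_one (by positivity)]
      exact hI1
    refine (pow_le_pow_left₀ h0 (Real.one_sub_le_exp_neg _) m).trans ?_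
    rw [← Real.exp_nat_mul, Real.exp_le_exp, mul_neg, neg_le_neg_iff]
    rw [div_le_iff₀ hI0] at hm1
    rw [← mul_div_assoc, le_div_iff₀ (by positivity)]
    exact hm1
  have hrec := minDeletionCoveringCard_recursion (by omega : 1 ≤ q) l k b m hb
  rw [hIcast] at hrec
  set K := (minDeletionCoveringCard q (l + k + b) (k + 1) : ℝ)
  set K1 := (minDeletionCoveringCard q b 1 : ℝ) with hK1
  set KR := (minDeletionCoveringCard q (b + k) (k + 1) : ℝ) with hKR
  have hK1n : 0 ≤ K1 := Nat.cast_nonneg _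
  have hKRn : 0 ≤ KR := Nat.cast_nonneg _
  have hbk : (0 : ℝ) < ((b + k : ℕ) : ℝ) := by exact_mod_cast (by omega : 0 < b + k)
  have hrec' : K ≤ (x * (q : ℝ) ^ (l + k) / I + 1) * K1 + Real.exp (-x) * (q : ℝ) ^ l * KR := by
    refine hrec.trans ?_
    gcongr
  set n : ℝ := ((l + k + b : ℕ) : ℝ) with hn
  have hkf : (0 : ℝ) < (k + 1).factorial := by exact_mod_cast Nat.factorial_pos _
  calc deletionDensity q (l + k + b) (k + 1)
      = K * (n ^ (k + 1) * ((q : ℝ) - 1) ^ (k + 1) /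
          ((q : ℝ) ^ (l + k + b) * (k + 1).factorial)) := by
        rw [deletionDensity]
        ring
    _ ≤ ((x * (q : ℝ) ^ (l + k) / I + 1) * K1 + Real.exp (-x) * (q : ℝ) ^ l * KR) *
        (n ^ (k + 1) * ((q : ℝ) - 1) ^ (k + 1) /
          ((q : ℝ) ^ (l + k + b) * (k + 1).factorial)) := by gcongr
    _ = _ := by
      rw [add_mul]
      congr 1
      · simp only [deletionDensity, ← hK1, hI, Nat.factorial_one, Nat.cast_one]
        field_simp
        ring
      · simp only [deletionDensity, ← hKR, div_pow]
        generalize ((b + k : ℕ) : ℝ) = B at hbk ⊢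
        field_simp
        ring

/-! ### Passing to the limit -/

open Filter Topology in
theorem eventually_le_of_contraction {d : ℕ → ℝ} {φ : ℕ → ℕ} {A θ z : ℝ} (hθ : 0 ≤ θ)
    (hθ1 : θ < 1) (hd : ∀ᶠ n in atTop, d n ≤ A + θ * d (φ n)) (hlt : ∀ᶠ n in atTop, φ n < n)
    (hφ : Tendsto φ atTop atTop) (hz : A < z * (1 - θ)) : ∀ᶠ n in atTop, d n ≤ z := by
  obtain ⟨N, hN⟩ := eventually_atTop.1 (hd.and hlt)
  set c := A / (1 - θ) with hc
  have h1 : 0 < 1 - θ := by linarith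
  have hcA : A + θ * c = c := by
    rw [hc]
    field_simp
    ring
  -- Iteration needs an a priori bound. Any constant at least the fixed point `c` is preserved by t
  -- ↦ A + θt, so strong induction extends a bound on the first N terms.
  obtain ⟨B, hB⟩ : ∃ B, ∀ n, d n ≤ B := by
    obtain ⟨B₀, hB₀⟩ := ((Finset.range N).image d).bddAbove
    refine ⟨max B₀ c, fun n => ?_⟩
    induction n using Nat.strong_induction_on with
    | _ n ih =>
      rcases Nat.lt_or_ge n N with h | h
      · exact (hB₀ (by
          simp only [Finset.coe_image, Set.mem_image, Finset.coe_range, Set.mem_Iio]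
          exact ⟨n, h, rfl⟩)).trans (le_max_left _ _)
      · obtain ⟨h2, h3⟩ := hN n h
        have h4 := mul_le_mul_of_nonneg_left (ih _ h3) hθ
        have h5 := mul_le_mul_of_nonneg_right (le_max_right B₀ c) h1.le
        nlinarith
  have hiter : ∀ j : ℕ, ∀ᶠ n in atTop, d n ≤ c + θ ^ j * (B - c) := by
    intro j
    induction j with
    | zero => exact Eventually.of_forall fun n => by simpa using hB n
    | succ j ih =>
      filter_upwards [hd, hφ.eventually ih] with n h2 h3
      have h4 := mul_le_mul_of_nonneg_left h3 hθ
      rw [pow_succ]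
      linarith
  have hlim : Tendsto (fun j : ℕ => c + θ ^ j * (B - c)) atTop (𝓝 (c + 0 * (B - c))) :=
    ((tendsto_pow_atTop_nhds_zero_of_lt_one hθ hθ1).mul_const _).const_add _
  have hcz : c + 0 * (B - c) < z := by
    rw [zero_mul, add_zero, hc, div_lt_iff₀ h1]
    exact hz
  obtain ⟨j, hj⟩ := (hlim.eventually (gt_mem_nhds hcz)).exists
  exact (hiter j).mono fun n hn => hn.trans hj.le

open Filter Topology in
theorem tendsto_natDiv_div (R : ℕ) :
    Tendsto (fun n : ℕ => ((n / R : ℕ) : ℝ) / n) atTop (𝓝 (1 / R)) := by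
  have h := (tendsto_nat_floor_mul_div_atTop (R := ℝ) (a := 1 / R) (by positivity)).comp
    tendsto_natCast_atTop_atTop
  refine h.congr fun n => ?_
  simp only [Function.comp]
  rw [← Nat.floor_div_eq_div (K := ℝ)]
  congr 3
  ring

open Filter Topology in
theorem tendsto_sub_natDiv_div (R : ℕ) :
    Tendsto (fun n : ℕ => ((n - n / R : ℕ) : ℝ) / n) atTop (𝓝 (1 - 1 / R)) := by
  refine ((tendsto_natDiv_div R).const_sub 1).congr' ?_
  filter_upwards [eventually_gt_atTop 0] with n hn
  have : (n : ℝ) ≠ 0 := by positivity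
  rw [Nat.cast_sub (Nat.div_le_self _ _), sub_div, div_self this]

open Filter in
theorem tendsto_sub_natDiv_atTop {R : ℕ} (hR : 2 ≤ R) :
    Tendsto (fun n : ℕ => n - n / R) atTop atTop := by
  refine tendsto_atTop_mono (fun n => ?_) (Nat.tendsto_div_const_atTop (two_ne_zero))
  have := Nat.div_le_div_left (a := n) hR two_pos
  omega

open Filter Topology in
theorem tendsto_density_ratio {k : ℕ} (hk : 1 ≤ k) :
    Tendsto (fun n : ℕ => (n : ℝ) ^ (k + 1) /
      ((k + 1).factorial * ((n / (k + 1) : ℕ) : ℝ) * (n - n / (k + 1)).choose k)) atTop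
      (𝓝 ((1 + 1 / k) ^ k)) := by
  have hk0 : (k : ℝ) ≠ 0 := by positivity
  have h1 := (tendsto_natDiv_div (k + 1)).inv₀ (by positivity)
  have hsub : (1 : ℝ) - 1 / ((k + 1 : ℕ) : ℝ) = k / (k + 1) := by
    push_cast
    field_simp
    ring
  have hne : (1 : ℝ) - 1 / ((k + 1 : ℕ) : ℝ) ≠ 0 := by
    rw [hsub]
    positivity
  have h2 := ((tendsto_sub_natDiv_div (k + 1)).inv₀ hne).pow k
  -- Replacing C(a, k) by a^k/k!, with a ~ nk/(k + 1), reduces the limit to powers of n.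
  have h3 : Tendsto (fun a : ℕ => ((a : ℝ) ^ k / k.factorial) / a.choose k) atTop (𝓝 1) := by
    refine (Asymptotics.isEquivalent_iff_tendsto_one ?_).1 (isEquivalent_choose k).symm
    filter_upwards [eventually_ge_atTop k] with a ha
    exact_mod_cast (Nat.choose_pos ha).ne'
  have h4 := ((h1.mul h2).mul (h3.comp (tendsto_sub_natDiv_atTop (R := k + 1) (by omega)))).div_const
    ((k + 1 : ℕ) : ℝ)
  have hlim : ((1 / ((k + 1 : ℕ) : ℝ))⁻¹ * ((1 - 1 / ((k + 1 : ℕ) : ℝ))⁻¹) ^ k * 1) /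
      ((k + 1 : ℕ) : ℝ) = (1 + 1 / (k : ℝ)) ^ k := by
    have : ((1 : ℝ) - 1 / ((k + 1 : ℕ) : ℝ))⁻¹ = 1 + 1 / k := by
      rw [hsub]
      field_simp
    rw [this]
    field_simp
  rw [hlim] at h4
  refine h4.congr' ?_
  filter_upwards [eventually_ge_atTop (k + 1),
    (tendsto_sub_natDiv_atTop (R := k + 1) (by omega)).eventually (eventually_ge_atTop (k + 1))]
    with n hn ha
  have hb : (0 : ℝ) < ((n / (k + 1) : ℕ) : ℝ) := by
    exact_mod_cast Nat.div_pos hn (by omega)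
  have ha0 : (0 : ℝ) < ((n - n / (k + 1) : ℕ) : ℝ) := by exact_mod_cast (by omega)
  have hc : (0 : ℝ) < ((n - n / (k + 1)).choose k : ℝ) := by
    exact_mod_cast Nat.choose_pos (by omega)
  have hn0 : (0 : ℝ) < n := by exact_mod_cast (by omega)
  simp only [Function.comp, Nat.factorial_succ, Nat.cast_mul, inv_div, div_pow]
  field_simp
  ring

theorem one_add_one_div_pow_le_exp {k : ℕ} (hk : 1 ≤ k) :
    (1 + 1 / (k : ℝ)) ^ k ≤ Real.exp 1 := by
  have hk0 : (k : ℝ) ≠ 0 := by positivity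
  have h := pow_le_pow_left₀ (by positivity) (Real.add_one_le_exp (1 / (k : ℝ))) k
  rw [← Real.exp_nat_mul, mul_one_div_cancel hk0] at h
  rwa [add_comm]

open Filter Topology in
theorem tendsto_choose_mul_pow_div_pow {q : ℕ} (hq : 2 ≤ q) (k : ℕ) :
    Tendsto (fun a : ℕ => (a.choose k : ℝ) * ((q : ℝ) - 1) ^ k / (q : ℝ) ^ a) atTop (𝓝 0) := by
  have hq1 : (1 : ℝ) < q := by exact_mod_cast (by omega : 1 < q)
  have hQ : (0 : ℝ) < (q : ℝ) - 1 := by linarith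
  have h := (tendsto_pow_const_div_const_pow_of_one_lt k hq1).mul_const (((q : ℝ) - 1) ^ k)
  rw [zero_mul] at h
  refine squeeze_zero (fun a => by positivity) (fun a => ?_) h
  rw [mul_div_right_comm]
  gcongr
  exact_mod_cast Nat.choose_le_pow a k

open Filter Topology in
theorem eventually_deletionDensity_le {q k : ℕ} (hq : 2 ≤ q) (hk : 1 ≤ k) {x L z : ℝ}
    (hx : 0 ≤ x) (hL : 0 ≤ L) (hxθ : Real.exp (-x) * ((k : ℝ) + 1) ^ (k + 1) < 1)
    (h1 : ∀ᶠ n in atTop, deletionDensity q n 1 ≤ L)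
    (hz : Real.exp 1 * x * L < z * (1 - Real.exp (-x) * ((k : ℝ) + 1) ^ (k + 1))) :
    ∀ᶠ n in atTop, deletionDensity q n (k + 1) ≤ z := by
  set θ := Real.exp (-x) * ((k : ℝ) + 1) ^ (k + 1) with hθ
  obtain ⟨A, hA1, hA2⟩ := exists_between hz
  have ha := tendsto_sub_natDiv_atTop (R := k + 1) (by omega)
  have hb : Tendsto (fun n : ℕ => n / (k + 1)) atTop atTop :=
    Nat.tendsto_div_const_atTop (by omega)
  have hlim := ((tendsto_density_ratio hk).mul
    (((tendsto_choose_mul_pow_div_pow hq k).comp ha).const_add x)).mul_const L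
  rw [add_zero] at hlim
  have hlt : (1 + 1 / (k : ℝ)) ^ k * x * L < A := by
    refine lt_of_le_of_lt ?_ hA1
    gcongr
    exact one_add_one_div_pow_le_exp hk
  refine eventually_le_of_contraction (φ := fun n => n / (k + 1) + k) (A := A) (θ := θ)
    (by positivity) hxθ ?_ ?_ (tendsto_atTop_mono (fun n => Nat.le_add_right _ k) hb) hA2
  · filter_upwards [hlim.eventually (gt_mem_nhds hlt), hb.eventually h1,
      hb.eventually (eventually_ge_atTop 1), ha.eventually (eventually_ge_atTop k)]
      with n hn1 hn2 hn3 hn4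
    have hdiv : n / (k + 1) ≤ n := Nat.div_le_self _ _
    have hrec := deletionDensity_recursion hq (n - n / (k + 1) - k) k (n / (k + 1)) hn3 hx
    have e1 : n - n / (k + 1) - k + k = n - n / (k + 1) := by omega
    have e2 : n - n / (k + 1) + n / (k + 1) = n := by omega
    rw [e1, e2] at hrec
    refine hrec.trans (add_le_add ?_ ?_)
    · refine le_trans ?_ hn1.le
      have hQ : (0 : ℝ) ≤ (q : ℝ) - 1 := by
        rw [sub_nonneg]
        exact_mod_cast (by omega : 1 ≤ q)
      simp only [Function.comp]
      gcongr
    · refine mul_le_mul_of_nonneg_right ?_ (deletionDensity_nonneg (by omega) _ _)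
      rw [hθ]
      gcongr
      -- The remainder of n modulo k + 1 is at most k ≤ (k + 1)k, so n/(b + k) ≤ k + 1 holds exactly
      -- despite the floor in b.
      rw [div_le_iff₀ (by exact_mod_cast (by omega))]
      have hmod := Nat.div_add_mod n (k + 1)
      have hmod' := Nat.mod_lt n (Nat.succ_pos k)
      have : n ≤ (k + 1) * (n / (k + 1) + k) := by nlinarith
      exact_mod_cast this
  · filter_upwards [eventually_ge_atTop (2 * k + 1)] with n hn
    have := Nat.div_le_div_left (a := n) (by omega : 2 ≤ k + 1) two_pos
    omega

/-! ### Choice of x and conclusion -/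

/-- Equivalent to M + y + 1 ≤ exp y for y = √(2M), the quadratic Taylor bound; this dictates the
square-root term. -/
theorem covering_constant_inequality {M : ℝ} (hM : 0 < M) :
    Real.exp 1 * (M + Real.sqrt (2 * M)) ≤
      Real.exp 1 * (M + Real.sqrt (2 * M) + 1) * (1 - Real.exp (-Real.sqrt (2 * M))) := by
  set y := Real.sqrt (2 * M) with hy
  have hy0 : 0 ≤ y := Real.sqrt_nonneg _
  have hy2 : y ^ 2 = 2 * M := Real.sq_sqrt (by positivity)
  have h := Real.quadratic_le_exp_of_nonneg hy0
  have h2 : (M + y + 1) * Real.exp (-y) ≤ 1 := by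
    rw [Real.exp_neg, ← div_eq_mul_inv, div_le_one (Real.exp_pos _)]
    linarith
  rw [mul_assoc]
  gcongr
  linarith

open Filter in
theorem asympDeletionDensity_one_le {q : ℕ} (hq : 2 ≤ q) :
    asympDeletionDensity q 1 ≤ (((q : ℝ) - 1 : ℝ) : EReal) :=
  limsup_le_of_le (by isBoundedDefault)
    (Eventually.of_forall fun n => EReal.coe_le_coe_iff.2 (deletionDensity_one_le hq n))

open Filter in
theorem asympDeletionDensity_nonneg {q : ℕ} (hq : 1 ≤ q) (R : ℕ) :
    0 ≤ asympDeletionDensity q R :=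
  le_limsup_of_frequently_le (Frequently.of_forall fun n =>
    EReal.coe_nonneg.2 (deletionDensity_nonneg hq n R)) (by isBoundedDefault)

open Filter in
theorem asympDeletionDensity_le_mul {q R : ℕ} (hq : 2 ≤ q) (hR : 2 ≤ R) :
    asympDeletionDensity q R ≤
      ((Real.exp 1 * (R * Real.log R + Real.sqrt (2 * R * Real.log R) + 1) : ℝ) : EReal) *
        asympDeletionDensity q 1 := by
  have h0 := asympDeletionDensity_nonneg (by omega : 1 ≤ q) 1
  have h1 := asympDeletionDensity_one_le hq
  obtain ⟨r, hr⟩ : ∃ r : ℝ, asympDeletionDensity q 1 = (r : EReal) :=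
    ⟨_, (EReal.coe_toReal (h1.trans_lt (EReal.coe_lt_top _)).ne
      ((EReal.bot_lt_zero).trans_le h0).ne').symm⟩
  rw [hr] at h0 ⊢
  have hr0 : 0 ≤ r := EReal.coe_nonneg.1 h0
  have hR1 : (1 : ℝ) < R := by exact_mod_cast (by omega : 1 < R)
  have hlog : 0 < Real.log R := Real.log_pos hR1
  set M := R * Real.log R with hM
  have hM0 : 0 < M := by positivity
  have hineq := covering_constant_inequality hM0
  rw [mul_assoc 2 (R : ℝ), ← hM]
  set y := Real.sqrt (2 * M) with hy
  have hy0 : 0 < y := Real.sqrt_pos.2 (by positivity)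
  set E := Real.exp 1 * (M + y + 1) with hE
  have hE0 : 0 < E := by positivity
  rw [← EReal.coe_mul]
  refine EReal.le_of_forall_lt_iff_le.1 fun z hz => ?_
  rw [EReal.coe_lt_coe_iff] at hz
  -- A slightly larger L > μ*(1) with E·L < z eventually bounds the 1-deletion densities and leaves
  -- the strict slack that the contraction argument needs.
  obtain ⟨L, hL1, hL2⟩ := exists_between ((lt_div_iff₀' hE0).2 hz)
  rw [lt_div_iff₀' hE0] at hL2
  have hev : ∀ᶠ n in atTop, deletionDensity q n 1 ≤ L := by
    have : asympDeletionDensity q 1 < (L : EReal) := by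
      rw [hr]
      exact EReal.coe_lt_coe_iff.2 hL1
    filter_upwards [eventually_lt_of_limsup_lt this] with n hn
    exact (EReal.coe_lt_coe_iff.1 hn).le
  obtain ⟨k, rfl⟩ : ∃ k, R = k + 1 := ⟨R - 1, by omega⟩
  have hθ : Real.exp (-(M + y)) * ((k : ℝ) + 1) ^ (k + 1) = Real.exp (-y) := by
    have : ((k : ℝ) + 1) ^ (k + 1) = Real.exp M := by
      rw [hM, Real.exp_nat_mul, Real.exp_log (by positivity)]
      push_cast
      rfl
    rw [this, ← Real.exp_add]
    congr 1
    ring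
  have hy1 : Real.exp (-y) < 1 := by
    rw [Real.exp_lt_one_iff]
    linarith
  have hL0 : 0 < L := hr0.trans_lt hL1
  refine limsup_le_of_le (by isBoundedDefault) ?_
  filter_upwards [eventually_deletionDensity_le (x := M + y) hq (by omega : 1 ≤ k)
    (by positivity) hL0.le (by rwa [hθ]) hev (z := z) (by
      rw [hθ]
      calc Real.exp 1 * (M + y) * L ≤ E * (1 - Real.exp (-y)) * L := by gcongr
        _ = E * L * (1 - Real.exp (-y)) := by ring
        _ < z * (1 - Real.exp (-y)) := by
          refine mul_lt_mul_of_pos_right hL2 ?_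
          linarith)] with n hn
  exact EReal.coe_le_coe_iff.2 hn

theorem mainTheorem3 (R : ℕ) (hR : 2 ≤ R) :
    (∀ q : ℕ, 2 ≤ q →
      asympDeletionDensity q 1 < ⊤ ∧
      asympDeletionDensity q R ≤
        ((Real.exp 1 * (R * Real.log R + Real.sqrt (2 * R * Real.log R) + 1) : ℝ) : EReal) *
          asympDeletionDensity q 1) ∧
    asympDeletionDensity 2 R ≤
      ((Real.exp 1 * (R * Real.log R + Real.sqrt (2 * R * Real.log R) + 1) : ℝ) : EReal) := by
  refine ⟨fun q hq => ⟨(asympDeletionDensity_one_le hq).trans_lt (EReal.coe_lt_top _),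
    asympDeletionDensity_le_mul hq hR⟩, ?_⟩
  refine (asympDeletionDensity_le_mul le_rfl hR).trans ?_
  have h1 : asympDeletionDensity 2 1 ≤ 1 := by
    refine (asympDeletionDensity_one_le le_rfl).trans (le_of_eq ?_)
    norm_num
  have hR1 : (1 : ℝ) ≤ R := by exact_mod_cast (by omega : 1 ≤ R)
  have hlog : 0 ≤ Real.log R := Real.log_nonneg hR1
  calc _ ≤ _ * (1 : EReal) :=
        mul_le_mul_of_nonneg_left h1 (EReal.coe_nonneg.2 (by positivity))
    _ = _ := mul_one _
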